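/- All structures are finite relational structures, and $\mathbf{A}\to\mathbf{B}$ denotes the existence of a homomorphism. For a structure $\mathbf{B}$ let $\wp(\mathbf{B})$ be the structure whose universe is the set of nonempty subsets of $B$ and in which each $k$-ary symbol $R$ is interpreted by $R^{\wp(\mathbf{B})}=\{(\pi_1 S,\dots,\pi_k S) : \emptyset\neq S\subseteq R^{\mathbf{B}}\}$, and let $\mathsf{Sing}(\wp(\mathbf{B})^n)$ be the induced substructure of $\wp(\mathbf{B})^n$ consisting of the $n$-tuples with at least one singleton coordinate. Peek arc consistency (PAC) solves $\mathsf{CSP}(\mathbf{B})$ if $\mathbf{A}\to\mathbf{B}$ holds for every structure $\mathbf{A}$ similar to $\mathbf{B}$ such that for every $a\in A$ there is a homomorphism $h:\mathbf{A}\to\wp(\mathbf{B})$ with $h(a)$ a singleton. Singleton arc consistency (SAC) solves $\mathsf{CSP}(\mathbf{B})$ if $\mathbf{A}\to\mathbf{B}$ holds for every structure $\mathbf{A}$ similar to $\mathbf{B}$ for which there is a map $s:A\to\wp(B)\setminus\{\emptyset\}$ such that for all $a\in A$ and $b\in s(a)$ there is a homomorphism $h:\mathbf{A}\to\wp(\mathbf{B})$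 with $h(a)=\{b\}$ and $h(a')\subseteq s(a')$ for all $a'\in A$. **Theorem.** Let $\mathbf{B}$ be the structure with universe $\{0,1,2,3\}$, unary relations $U_i^{\mathbf{B}}=\{(i)\}$ for $i=0,1,2,3$, and binary relations $$R_1^{\mathbf{B}}=\{0,1,2,3\}^2\setminus\{(0,0)\},\qquad R_2^{\mathbf{B}}=\{(1,2),(2,3),(3,1),(0,0)\}.$$ Then $\mathbf{B}$ has all constants, that is, for each $b\in B$ some unary relation of $\mathbf{B}$ is $\{(b)\}$. Let $*$ be the idempotent commutative binary operation on $\{0,1,2,3\}$ with $1*2=2$, $2*3=3$, $3*1=1$ and $0*a=a$ for $a\in\{1,2,3\}$. Then $*$ is a 2-semilattice operation (idempotent, commutative, and $x*(x*y)=(x*x)*y$ for all $x,y$), is conservative ($x*y\in\{x,y\}$ for all $x,y$), and is a polymorphism of $\mathbf{B}$ (each relation of $\mathbf{B}$ is closed under $*$ applied coordinatewise). Moreover, SAC solves $\mathsf{CSP}(\mathbf{B})$, there is no homomorphism $\mathsf{Sing}(\wp(\mathbf{B})^2)\to\mathbf{B}$, and PAC does not solve $\mathsf{CSP}(\mathbf{B})$.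 -/

import Mathlib

namespace ArcCons

open FirstOrder FirstOrder.Language FirstOrder.Language.Structure

/-- The universe `℘(B) \ {∅}` of the structure `℘(B)`. -/
def Pow.{x} (B : Type x) : Type x := {S : Set B // S.Nonempty}

/-- The set underlying an element of `℘(B) \ {∅}`. -/
def Pow.toSet.{x} {B : Type x} (S : Pow B) : Set B := S.1

/-- The relational structure `℘(B)`: a `k`-ary symbol `R` is interpreted by the tuples
`(π₁ S, …, π_k S)` for nonempty `S ⊆ R^B`. -/
instance powStructure.{u, v, x} (L : FirstOrder.Language.{u, v}) [L.IsRelational] (B : Type x)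
    [L.Structure B] : L.Structure (Pow B) where
  funMap f _ := isEmptyElim f
  RelMap {k} R T := ∃ S : Set (Fin k → B), S.Nonempty ∧ (∀ t ∈ S, RelMap R t) ∧
    ∀ i : Fin k, (T i).toSet = (fun t : Fin k → B => t i) '' S

/-- The power `M^n` of a structure, with universe `Fin n → M`. -/
instance productStructure.{u, v, x} (L : FirstOrder.Language.{u, v}) (M : Type x) [L.Structure M] (n : ℕ) :
    L.Structure (Fin n → M) where
  funMap f T := fun i => funMap f (fun j => T j i)
  RelMap R T := ∀ i, RelMap R (fun j => T j i)

/-- `Sing(℘(B)^n)`: the induced substructure of `℘(B)^n` on the `n`-tuples having at least one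
singleton coordinate. -/
def Sing.{u, v, x} (L : FirstOrder.Language.{u, v}) [L.IsRelational] (B : Type x) [L.Structure B] (n : ℕ) :
    L.Substructure (Fin n → Pow B) where
  carrier := {T | ∃ (i : Fin n) (b : B), (T i).toSet = {b}}
  fun_mem f := isEmptyElim f

/-- The peek arc consistency condition for the instance `(A, B)`. -/
def PACC.{u, v, w, x} (L : FirstOrder.Language.{u, v}) [L.IsRelational] (A : Type w) (B : Type x)
    [L.Structure A] [L.Structure B] : Prop :=
  ∀ a : A, ∃ h : A →[L] Pow B, ∃ b : B, (h a).toSet = {b}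

/-- The singleton arc consistency condition for the instance `(A, B)`. -/
def SACC.{u, v, w, x} (L : FirstOrder.Language.{u, v}) [L.IsRelational] (A : Type w) (B : Type x)
    [L.Structure A] [L.Structure B] : Prop :=
  ∃ s : A → Pow B, ∀ a : A, ∀ b ∈ (s a).toSet, ∃ h : A →[L] Pow B,
    (h a).toSet = {b} ∧ ∀ a' : A, (h a').toSet ⊆ (s a').toSet

/-- Peek arc consistency solves `CSP(B)`. Input structures are finite. -/
def PACSolves.{w, u, v, x} (L : FirstOrder.Language.{u, v}) [L.IsRelational] (B : Type x)
    [L.Structure B] : Prop :=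
  ∀ (A : Type w) [Finite A] [L.Structure A], PACC L A B → Nonempty (A →[L] B)

/-- Singleton arc consistency solves `CSP(B)`. Input structures are finite. -/
def SACSolves.{w, u, v, x} (L : FirstOrder.Language.{u, v}) [L.IsRelational] (B : Type x)
    [L.Structure B] : Prop :=
  ∀ (A : Type w) [Finite A] [L.Structure A], SACC L A B → Nonempty (A →[L] B)

/-- For each `b` there is a unary symbol interpreted by `{(b)}`. -/
def HasAllConstants.{u, v, x} (L : FirstOrder.Language.{u, v}) (B : Type x) [L.Structure B] : Prop :=
  ∀ b : B, ∃ R : L.Relations 1, {t : Fin 1 → B | RelMap R t} = {![b]}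

/-- The `n`-ary operation `f` preserves every relation of the relational structure `B`. -/
def IsPolymorphism.{u, v, x} (L : FirstOrder.Language.{u, v}) [L.IsRelational] {B : Type x} [L.Structure B]
    {n : ℕ} (f : (Fin n → B) → B) : Prop :=
  ∀ (k : ℕ) (R : L.Relations k) (t : Fin n → Fin k → B),
    (∀ i, RelMap R (t i)) → RelMap R (fun j => f (fun i => t i j))

structure IsTwoSemilattice.{x} {G : Type x} (op : G → G → G) : Prop where
  idem : ∀ x, op x x = x
  comm : ∀ x y, op x y = op y x
  restricted_assoc : ∀ x y, op x (op x y) = op (op x x) y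

def IsConservative.{x} {G : Type x} (op : G → G → G) : Prop :=
  ∀ x y, op x y ∈ ({x, y} : Set G)

/-- The relation symbols `U₀, U₁, U₂, U₃` (unary) and `R₁, R₂` (binary). -/
inductive TemplateSymbol : ℕ → Type
  | U (b : Fin 4) : TemplateSymbol 1
  | R₁ : TemplateSymbol 2
  | R₂ : TemplateSymbol 2

def templateSignature : FirstOrder.Language.{0, 0} := ⟨fun _ => Empty, TemplateSymbol⟩

instance templateSignature_isRelational : templateSignature.IsRelational :=
  fun _ => inferInstanceAs (IsEmpty Empty)

/-- The relations of the template on `{0, 1, 2, 3}`. -/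
def templateRel : {k : ℕ} → TemplateSymbol k → Set (Fin k → Fin 4)
  | _, .U b => {![b]}
  | _, .R₁ => Set.univ \ {![0, 0]}
  | _, .R₂ => {![1, 2], ![2, 3], ![3, 1], ![0, 0]}

/-- The template `B` with universe `{0, 1, 2, 3}`. -/
instance templateStructure : templateSignature.Structure (Fin 4) where
  funMap f _ := isEmptyElim f
  RelMap R t := t ∈ templateRel R

/-- The idempotent commutative operation on `{0, 1, 2, 3}` with `1 * 2 = 2`, `2 * 3 = 3`,
`3 * 1 = 1` and `0 * a = a`. -/
def star (a b : Fin 4) : Fin 4 :=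
  (![![0, 1, 2, 3],
     ![1, 1, 2, 1],
     ![2, 2, 2, 3],
     ![3, 1, 3, 3] ] : Fin 4 → Fin 4 → Fin 4) a b

end ArcCons

universe w

namespace ArcCons

open FirstOrder FirstOrder.Language FirstOrder.Language.Structure

/-! ### Peek arc consistency and `Sing(℘(B)^n)` -/

/-! `R₂` is the graph of the permutation `(1 2 3)`, whose only fixed point is `0`. PAC fails because
`({0}, {1,2,3})` and `({1,2,3}, {0})` are `R₂`-loops in `Sing(℘(B)^2)`, hence forced to `0`, yet
they are `R₁`-related (`isEmpty_hom_sing`); and `Sing(℘(B)^2)` itself passes the PAC test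
(`Sing.pacc`). For SAC, a homomorphism to `℘(B)` that is a singleton at one point is a singleton on
its whole `R₂`-component (`exists_singleton_iff`). Starting each component from a nonzero value of
`s` whenever there is one and gluing gives a map respecting `U` and `R₂`. It takes the value `0`
only where `s` is `{0}`, and SAC forbids `R₁` between two such points. -/

instance Pow.finite.{x} (B : Type x) [Finite B] : Finite (Pow B) :=
  inferInstanceAs (Finite {S : Set B // S.Nonempty})

/-- The `i`-th coordinate projection `Sing(℘(B)^n) → ℘(B)`. -/
def Sing.proj.{u, v, x} (L : FirstOrder.Language.{u, v}) [L.IsRelational] (B : Type x)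
    [L.Structure B] (n : ℕ) (i : Fin n) : Sing L B n →[L] Pow B where
  toFun T := T.1 i
  map_fun' f := isEmptyElim f
  map_rel' _ _ h := h i

/-- The projection to a singleton coordinate of the given point is the required homomorphism. -/
theorem Sing.pacc.{u, v, x} (L : FirstOrder.Language.{u, v}) [L.IsRelational] (B : Type x)
    [L.Structure B] (n : ℕ) : PACC L (Sing L B n) B := by
  rintro ⟨T, i, b, h⟩
  exact ⟨Sing.proj L B n i, b, h⟩

theorem PACC.comp.{u, v, y, y', x} {L : FirstOrder.Language.{u, v}} [L.IsRelational]
    {A : Type y} {A' : Type y'} {B : Type x} [L.Structure A] [L.Structure A'] [L.Structure B]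
    (h : PACC L A B) (g : A' →[L] A) : PACC L A' B := by
  intro a
  obtain ⟨k, b, hb⟩ := h (g a)
  exact ⟨k.comp g, b, hb⟩

theorem PACSolves.nonempty_hom_sing.{u, v} {L : FirstOrder.Language.{u, v}} [L.IsRelational]
    {B : Type} [Finite B] [L.Structure B] (h : PACSolves.{w} L B) (n : ℕ) :
    Nonempty (Sing L B n →[L] B) := by
  -- Instances live in `Type w`, so the structure is transported along `ULift`.
  let _ : L.Structure (ULift.{w} (Sing L B n)) := Equiv.ulift.symm.inducedStructure
  let e : Sing L B n ≃[L] ULift.{w} (Sing L B n) := Equiv.ulift.symm.inducedStructureEquiv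
  obtain ⟨f⟩ := h (ULift.{w} (Sing L B n)) ((Sing.pacc L B n).comp e.symm.toHom)
  exact ⟨f.comp e.toHom⟩

/-! ### The relations of the template -/

/-- The permutation `(1 2 3)` of `{0, 1, 2, 3}`, whose graph is `R₂`. -/
def rotation : Equiv.Perm (Fin 4) where
  toFun := ![0, 2, 3, 1]
  invFun := ![0, 3, 1, 2]
  left_inv := by decide
  right_inv := by decide

theorem rotation_eq_zero_iff {b : Fin 4} : rotation b = 0 ↔ b = 0 := by
  revert b; decide

theorem rotation_eq_self_iff {b : Fin 4} : rotation b = b ↔ b = 0 := by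
  revert b; decide

theorem relMap_U {b : Fin 4} {t : Fin 1 → Fin 4} :
    RelMap (L := templateSignature) (TemplateSymbol.U b) t ↔ t 0 = b := by
  change t ∈ ({![b]} : Set _) ↔ _
  simp [funext_iff]

theorem relMap_R₁ {t : Fin 2 → Fin 4} :
    RelMap (L := templateSignature) TemplateSymbol.R₁ t ↔ ¬ (t 0 = 0 ∧ t 1 = 0) := by
  change t ∈ (Set.univ \ {![0, 0]} : Set _) ↔ _
  simp [funext_iff, Fin.forall_fin_two]

theorem relMap_R₂ {t : Fin 2 → Fin 4} :
    RelMap (L := templateSignature) TemplateSymbol.R₂ t ↔ t 1 = rotation (t 0) := by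
  change t ∈ ({![1, 2], ![2, 3], ![3, 1], ![0, 0]} : Set _) ↔ _
  simp only [Set.mem_insert_iff, Set.mem_singleton_iff, funext_iff, Fin.forall_fin_two]
  generalize t 0 = a
  generalize t 1 = b
  revert a b
  decide

theorem toSet_of_relMap_U {b : Fin 4} {T : Fin 1 → Pow (Fin 4)}
    (h : RelMap (L := templateSignature) (TemplateSymbol.U b) T) : (T 0).toSet = {b} := by
  obtain ⟨S, hS, hR, hT⟩ := h
  rw [hT 0]
  exact (hS.image _).subset_singleton_iff.1 (by
    rintro _ ⟨t, ht, rfl⟩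
    exact relMap_U.1 (hR t ht))

theorem not_of_relMap_R₁ {T : Fin 2 → Pow (Fin 4)}
    (h : RelMap (L := templateSignature) TemplateSymbol.R₁ T) :
    ¬ ((T 0).toSet = {0} ∧ (T 1).toSet = {0}) := by
  rintro ⟨h₀, h₁⟩
  obtain ⟨S, ⟨t, ht⟩, hR, hT⟩ := h
  refine relMap_R₁.1 (hR t ht) ⟨?_, ?_⟩
  · have : t 0 ∈ (T 0).toSet := hT 0 ▸ ⟨t, ht, rfl⟩
    rwa [h₀] at this
  · have : t 1 ∈ (T 1).toSet := hT 1 ▸ ⟨t, ht, rfl⟩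
    rwa [h₁] at this

theorem pow_relMap_R₂ {T : Fin 2 → Pow (Fin 4)} :
    RelMap (L := templateSignature) TemplateSymbol.R₂ T ↔
      (T 1).toSet = rotation '' (T 0).toSet := by
  constructor
  · rintro ⟨S, -, hR, hT⟩
    rw [hT 0, hT 1, Set.image_image]
    exact Set.image_congr fun t ht => relMap_R₂.1 (hR t ht)
  · intro h
    refine ⟨(fun b => ![b, rotation b]) '' (T 0).toSet, (T 0).2.image _, ?_, ?_⟩
    · rintro _ ⟨b, -, rfl⟩
      exact relMap_R₂.2 rfl
    · rw [Fin.forall_fin_two, h, Set.image_image, Set.image_image]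
      exact ⟨(Set.image_id _).symm, rfl⟩

/-- A product `S × S'` of nonempty subsets avoiding `(0, 0)` witnesses `R₁`. -/
theorem pow_relMap_R₁ {T : Fin 2 → Pow (Fin 4)}
    (h : ¬ (0 ∈ (T 0).toSet ∧ 0 ∈ (T 1).toSet)) :
    RelMap (L := templateSignature) TemplateSymbol.R₁ T := by
  obtain ⟨a, ha⟩ := (T 0).2
  obtain ⟨b, hb⟩ := (T 1).2
  refine ⟨{t | t 0 ∈ (T 0).toSet ∧ t 1 ∈ (T 1).toSet}, ⟨![a, b], ha, hb⟩, ?_, ?_⟩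
  · rintro t ⟨h₀, h₁⟩
    exact relMap_R₁.2 fun ⟨e₀, e₁⟩ => h ⟨e₀ ▸ h₀, e₁ ▸ h₁⟩
  · rw [Fin.forall_fin_two]
    constructor
    · ext c
      exact ⟨fun hc => ⟨![c, b], ⟨hc, hb⟩, rfl⟩, by rintro ⟨t, ht, rfl⟩; exact ht.1⟩
    · ext c
      exact ⟨fun hc => ⟨![a, c], ⟨ha, hc⟩, rfl⟩, by rintro ⟨t, ht, rfl⟩; exact ht.2⟩

theorem template_hasAllConstants : HasAllConstants templateSignature (Fin 4) :=
  fun b => ⟨TemplateSymbol.U b, rfl⟩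

/-! ### The operation `star` -/

theorem star_isTwoSemilattice : IsTwoSemilattice star :=
  ⟨by decide, by decide, by decide⟩

theorem star_isConservative : IsConservative star := by
  simp only [IsConservative, Set.mem_insert_iff, Set.mem_singleton_iff]
  decide

theorem star_eq_zero_iff {a b : Fin 4} : star a b = 0 ↔ a = 0 ∧ b = 0 := by
  revert a b; decide

theorem rotation_star (a b : Fin 4) : rotation (star a b) = star (rotation a) (rotation b) := by
  revert a b; decide

/-- `R₁` is preserved since `star` yields `0` only from two zeros, and `R₂` since `rotation` is an
automorphism of `star`. -/
theorem star_isPolymorphism :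
    IsPolymorphism templateSignature (fun t : Fin 2 → Fin 4 => star (t 0) (t 1)) := by
  rintro k (b | _ | _) t h
  · have h' := fun i => relMap_U.1 (h i)
    refine relMap_U.2 ?_
    simp only [h', star_isTwoSemilattice.idem]
  · have h' := fun i => relMap_R₁.1 (h i)
    refine relMap_R₁.2 ?_
    simp only [star_eq_zero_iff]
    exact fun ⟨e₀, e₁⟩ => h' 0 ⟨e₀.1, e₁.1⟩
  · have h' := fun i => relMap_R₂.1 (h i)
    refine relMap_R₂.2 ?_
    simp only [h', rotation_star]

/-! ### Failure of peek arc consistency -/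

theorem isEmpty_hom_sing :
    IsEmpty (Sing templateSignature (Fin 4) 2 →[templateSignature] Fin 4) := by
  refine ⟨fun f => ?_⟩
  let z : Pow (Fin 4) := ⟨{0}, Set.singleton_nonempty 0⟩
  -- The sets `{0}` and `{0}ᶜ` are both invariant under `rotation`, and their product avoids `(0,
  -- 0)`.
  let c : Pow (Fin 4) := ⟨{0}ᶜ, 1, by decide⟩
  let x : Sing templateSignature (Fin 4) 2 := ⟨![z, c], 0, 0, rfl⟩
  let y : Sing templateSignature (Fin 4) 2 := ⟨![c, z], 1, 0, rfl⟩
  have hz : z.toSet = rotation '' z.toSet := by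
    change ({0} : Set (Fin 4)) = rotation '' {0}
    rw [Set.image_singleton]; rfl
  have hc : c.toSet = rotation '' c.toSet := by
    change ({0}ᶜ : Set (Fin 4)) = rotation '' {0}ᶜ
    rw [Set.image_compl_eq rotation.bijective, Set.image_singleton]; rfl
  have hx : f x = 0 := by
    have h : RelMap (L := templateSignature) TemplateSymbol.R₂ ![x, x] :=
      Fin.forall_fin_two.2 ⟨pow_relMap_R₂.2 hz, pow_relMap_R₂.2 hc⟩
    exact rotation_eq_self_iff.1 (relMap_R₂.1 (f.map_rel _ _ h)).symm
  have hy : f y = 0 := by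
    have h : RelMap (L := templateSignature) TemplateSymbol.R₂ ![y, y] :=
      Fin.forall_fin_two.2 ⟨pow_relMap_R₂.2 hc, pow_relMap_R₂.2 hz⟩
    exact rotation_eq_self_iff.1 (relMap_R₂.1 (f.map_rel _ _ h)).symm
  have h : RelMap (L := templateSignature) TemplateSymbol.R₁ ![x, y] :=
    Fin.forall_fin_two.2 ⟨pow_relMap_R₁ fun h => h.2 rfl, pow_relMap_R₁ fun h => h.1 rfl⟩
  exact relMap_R₁.1 (f.map_rel _ _ h) ⟨hx, hy⟩

/-! ### Correctness of singleton arc consistency -/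

section SAC

variable {A : Type*} [templateSignature.Structure A]

/-- The equivalence relation whose classes are the `R₂`-connected components. -/
def componentSetoid (A : Type*) [templateSignature.Structure A] : Setoid A :=
  Relation.EqvGen.setoid fun a a' =>
    RelMap (L := templateSignature) TemplateSymbol.R₂ ![a, a']

theorem iff_of_componentSetoid {P : A → Prop}
    (hP : ∀ a a', RelMap (L := templateSignature) TemplateSymbol.R₂ ![a, a'] → (P a ↔ P a'))
    {a a' : A} (h : componentSetoid A a a') : P a ↔ P a' := by
  induction h with
  | rel a a' h => exact hP a a' h
  | refl a => rfl
  | symm a a' _ ih => exact ih.symm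
  | trans a b c _ _ ih ih' => exact ih.trans ih'

theorem toSet_hom_eq_image (h : A →[templateSignature] Pow (Fin 4)) {a a' : A}
    (haa' : RelMap (L := templateSignature) TemplateSymbol.R₂ ![a, a']) :
    (h a').toSet = rotation '' (h a).toSet :=
  pow_relMap_R₂.1 (h.map_rel _ _ haa')

theorem image_rotation_eq_singleton_iff {S : Set (Fin 4)} {b : Fin 4} :
    rotation '' S = {rotation b} ↔ S = {b} := by
  rw [← Set.image_singleton, rotation.injective.image_injective.eq_iff]

/-- If a homomorphism to `℘(B)` has the singleton value `{b}` at a point, then on the component of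
that point all values are singletons, and they differ from `{0}` if `b ≠ 0`. -/
theorem exists_singleton_iff (h : A →[templateSignature] Pow (Fin 4)) {a a' : A}
    (haa' : componentSetoid A a a') (P : Prop) :
    (∃ b, (h a).toSet = {b} ∧ (b = 0 → P)) ↔ ∃ b, (h a').toSet = {b} ∧ (b = 0 → P) := by
  refine iff_of_componentSetoid (P := fun a => ∃ b, (h a).toSet = {b} ∧ (b = 0 → P)) ?_ haa'
  intro a a' haa'
  simp only [toSet_hom_eq_image h haa']
  rw [rotation.surjective.exists
    (p := fun b => rotation '' (h a).toSet = {b} ∧ (b = 0 → P))]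
  simp only [image_rotation_eq_singleton_iff, rotation_eq_zero_iff]

theorem template_sacSolves : SACSolves.{w} templateSignature (Fin 4) := by
  intro A _ _ ⟨s, hs⟩
  -- `s` need not be a homomorphism, but each of its values is attained by one lying below `s`, so
  -- `s` follows `rotation` along `R₂`.
  have hmem : ∀ a a', RelMap (L := templateSignature) TemplateSymbol.R₂ ![a, a'] →
      ∀ b, b ∈ (s a).toSet ↔ rotation b ∈ (s a').toSet := by
    intro a a' haa' b
    constructor
    · intro hb
      obtain ⟨h, ha, hsub⟩ := hs a b hb
      apply hsub a'
      rw [toSet_hom_eq_image h haa', ha]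
      exact ⟨b, rfl, rfl⟩
    · intro hb
      obtain ⟨h, ha, hsub⟩ := hs a' _ hb
      apply hsub a
      rw [toSet_hom_eq_image h haa', image_rotation_eq_singleton_iff] at ha
      rw [ha]; rfl
  have hzero : ∀ a a', componentSetoid A a a' →
      ((s a).toSet = {0} ↔ (s a').toSet = {0}) := by
    intro a a' haa'
    refine iff_of_componentSetoid (P := fun a => (s a).toSet = {0}) (fun a a' haa' => ?_) haa'
    have : (s a').toSet = rotation '' (s a).toSet := by
      ext c
      obtain ⟨b, rfl⟩ := rotation.surjective c
      rw [← hmem a a' haa', rotation.injective.mem_set_image]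
    rw [this]
    exact (image_rotation_eq_singleton_iff (b := 0)).symm
  have hchoice : ∀ a, ∃ h : A →[templateSignature] Pow (Fin 4),
      ∃ b, (h a).toSet = {b} ∧ (b = 0 → (s a).toSet = {0}) := by
    intro a
    by_cases ha : (s a).toSet = {0}
    · obtain ⟨h, hh, -⟩ := hs a 0 (ha ▸ rfl)
      exact ⟨h, 0, hh, fun _ => ha⟩
    · obtain ⟨b, hb, hb0⟩ : ∃ b ∈ (s a).toSet, b ≠ 0 := by
        by_contra! hall
        exact ha ((Set.Nonempty.subset_singleton_iff (s a).2).1 hall)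
      obtain ⟨h, hh, -⟩ := hs a b hb
      exact ⟨h, b, hh, fun e => absurd e hb0⟩
  choose H hH using hchoice
  -- One homomorphism per component, so that both ends of an `R₂`-edge use the same one.
  let rep : A → A := fun a => (Quotient.mk (componentSetoid A) a).out
  have hrep : ∀ a, componentSetoid A (rep a) a := fun a => Quotient.mk_out (s := componentSetoid A) a
  have hsing : ∀ a, ∃ b, (H (rep a) a).toSet = {b} ∧ (b = 0 → (s a).toSet = {0}) := by
    intro a
    have := (exists_singleton_iff (H (rep a)) (hrep a) ((s (rep a)).toSet = {0})).1 (hH (rep a))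
    rwa [hzero _ _ (hrep a)] at this
  choose f hf hf0 using hsing
  refine ⟨⟨f, fun g => isEmptyElim g, ?_⟩⟩
  rintro k (b | _ | _) t ht
  · refine relMap_U.2 ?_
    have := toSet_of_relMap_U ((H (rep (t 0))).map_rel _ _ ht)
    exact Set.singleton_injective ((hf (t 0)).symm.trans this)
  · refine relMap_R₁.2 fun ⟨e₀, e₁⟩ => ?_
    have h₀ := hf0 _ e₀
    have h₁ := hf0 _ e₁
    -- Any homomorphism below `s` is forced to `{0}` at both ends, which `R₁` excludes.
    obtain ⟨h, -, hsub⟩ := hs (t 0) 0 (h₀ ▸ rfl)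
    refine not_of_relMap_R₁ (h.map_rel _ _ ht) ⟨?_, ?_⟩
    · exact (Set.Nonempty.subset_singleton_iff (h (t 0)).2).1 ((hsub _).trans h₀.subset)
    · exact (Set.Nonempty.subset_singleton_iff (h (t 1)).2).1 ((hsub _).trans h₁.subset)
  · refine relMap_R₂.2 ?_
    have hr : rep (t 0) = rep (t 1) := by
      have : componentSetoid A (t 0) (t 1) := by
        refine Relation.EqvGen.rel _ _ ?_
        convert ht using 1
        ext i; fin_cases i <;> rfl
      exact congrArg Quotient.out (Quotient.sound (s := componentSetoid A) this)
    have h := pow_relMap_R₂.1 ((H (rep (t 0))).map_rel _ _ ht)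
    have h₁ := hf (t 1)
    rw [← hr] at h₁
    change (H (rep (t 0)) (t 1)).toSet = rotation '' (H (rep (t 0)) (t 0)).toSet at h
    rw [h₁, hf (t 0), Set.image_singleton] at h
    exact Set.singleton_injective h

end SAC

end ArcCons

theorem theorem22 :
    ArcCons.HasAllConstants ArcCons.templateSignature (Fin 4) ∧
    ArcCons.IsTwoSemilattice ArcCons.star ∧
    ArcCons.IsConservative ArcCons.star ∧
    ArcCons.IsPolymorphism ArcCons.templateSignature
      (fun t : Fin 2 → Fin 4 => ArcCons.star (t 0) (t 1)) ∧
    ArcCons.SACSolves.{w} ArcCons.templateSignature (Fin 4) ∧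
    ¬ ArcCons.PACSolves.{w} ArcCons.templateSignature (Fin 4) ∧
    IsEmpty (FirstOrder.Language.Hom ArcCons.templateSignature
      (ArcCons.Sing ArcCons.templateSignature (Fin 4) 2) (Fin 4)) :=
  ⟨ArcCons.template_hasAllConstants, ArcCons.star_isTwoSemilattice, ArcCons.star_isConservative,
    ArcCons.star_isPolymorphism, ArcCons.template_sacSolves,
    fun h => not_isEmpty_iff.2 (h.nonempty_hom_sing 2) ArcCons.isEmpty_hom_sing,
    ArcCons.isEmpty_hom_sing⟩
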